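/- For integers $n\ge 3$ and $1\le k<n/2$, the generalized Petersen graph $GP(n,k)$ has vertices $u_i,v_i$ ($i\in\mathbb Z_n$) and edges $u_iu_{i+1}$, $v_iv_{i+k}$, $u_iv_i$ ($i\in\mathbb Z_n$). Let $d$ be its distance function. Call an integer $p$ with $0\le p\le n/2$ a *peak index* if $$d(u_0,v_p)=\max_{i\in\mathbb Z_n} d(u_0,v_i)\quad\text{and}\quad \operatorname{diam}(GP(n,k))=d(u_0,u_p)=d(u_0,v_p)+1 .$$ **Theorem.** Let $n,k$ be integers with $3\le k<n/2$, and suppose that $n\ge 8$ if $k=3$; $n\ge 10$ if $k=4$; $n\ge k(k+1)/2$ if $k\ge5$ is odd; $n\ge k^2/2$ if $k\ge 6$ is even. Write $D=\operatorname{diam}(GP(n,k))$, and let $m\ge 0$ and $0\le j<k$ be the integers with $n/2=mk+j$ if $n$ is even, and $(n-1)/2=mk+j$ if $n$ is odd. Then $D$ has the following value, and each listed $j^*$ is a peak index. 1. $k$ odd, $n$ even, $\frac{k-1}2\le j<k$: - if $j=\frac{k-1}2$ or $j=\frac{k+1}2$: $D=m+2+j$, $j^*=mk+j$; - if $3\le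 2j-k\le\frac{k+1}2$: $D=m+3+k-j$, $j^*=mk+j$; - if $2j-k>\frac{k+1}2$: $D=m+2+j-\frac{k-1}2$, $j^*=mk+j-\frac{k-1}2$. 2. $k$ odd, $n$ even, $0\le j<\frac{k-1}2$: - if $j=0$ or $j=1$: $D=m+1+\frac{k+1}2$, $j^*=(m-1)k+\frac{k+1}2$; - if $4\le 2j\le\frac{k+1}2$: $D=m+3+\frac{k-1}2-j$, $j^*=(m-1)k+\frac{k+1}2+j-1$; - if $2j>\frac{k+1}2$: $D=m+2+j$, $j^*=(m-1)k+j+1$. 3. $k$ odd, $n$ odd, $\frac{k-2}2\le j<k$: - if $j=\frac{k-1}2$: $D=m+2+\frac{k-1}2$, $j^*=mk+\frac{k-1}2$; - if $2\le 2j+1-k\le\frac{k+1}2$: $D=m+2+k-j$, $j^*=mk+j$; - if $2j+1-k>\frac{k+1}2$: $D=m+2+j-\frac{k-1}2$, $j^*=mk+j-\frac{k-3}2$ and $j^*=mk+j-\frac{k-1}2$. 4. $k$ odd, $n$ odd, $0\le j<\frac{k-2}2$: - if $1\le 2j+1\le\frac{k+1}2$: $D=m+2+\frac{k-1}2-j$;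 if $j=0$, $j^*=(m-1)k+\frac{k+1}2$; if $j\ge1$, $j^*=(m-1)k+\frac{k+1}2+j-1$ and $j^*=(m-1)k+\frac{k+1}2+j$; - if $2j+1>\frac{k+1}2$: $D=m+2+j$, $j^*=(m-1)k+j+2$ and $j^*=(m-1)k+j+1$. 5. $k$ even, $n$ even, $\frac{k-2}2\le j<k$: - if $j=\frac{k-2}2$ or $j=\frac k2$: $D=m+2+j$, $j^*=mk+j$; - if $2\le 2j-k\le\frac k2$: $D=m+3+k-j$, $j^*=mk+j$; - if $2j-k\ge\frac{k+2}2$: $D=m+2+j-\frac k2$, $j^*=mk+j-\frac k2+1$ and $j^*=mk+j-\frac k2$. 6. $k$ even, $n$ even, $0\le j<\frac{k-2}2$: - if $j=0$: $D=m+1+\frac k2$, $j^*=(m-1)k+\frac k2$; - if $2\le 2j\le\frac k2$: $D=m+2+\frac k2-j$, $j^*=(m-1)k+\frac k2+j-1$ and, if $j\ge2$, also $j^*=(m-1)k+\frac k2+j$; - if $2j\ge\frac{k+2}2$: $D=m+2+j$, $j^*=(m-1)k+j+1$. 7. $k$ even, $n$ odd, $\frac{k-3}2\le j<k$: - if $j=\frac{k-2}2$: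 $D=m+2+\frac{k-2}2$, $j^*=mk+j$; - if $1\le 2j+1-k\le\frac k2$: $D=m+2+k-j$, $j^*=mk+j$; - if $2j+1-k\ge\frac{k+2}2$: $D=m+3+j-\frac k2$, $j^*=mk+j+1-\frac k2$. 8. $k$ even, $n$ odd, $0\le j<\frac{k-3}2$: - if $j=0$: $D=m+1+\frac k2$, $j^*=(m-1)k+\frac k2$; - if $3\le 2j+1\le\frac k2$: $D=m+2+\frac k2-j$, $j^*=(m-1)k+\frac k2+j$; - if $2j+1\ge\frac{k+2}2$: $D=m+2+j$, $j^*=(m-1)k+j+2$ and $j^*=(m-1)k+j+1$. -/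

import Mathlib

namespace GeneralizedPetersen

/-- The vertices `u_i` and `v_i`, with `i` an integer modulo `n`. -/
inductive Vertex (n : ℕ) : Type
  | u (i : ZMod n) : Vertex n
  | v (i : ZMod n) : Vertex n

/-- The generalized Petersen graph `GP(n,k)`: its edges are the pairs `u_i u_{i+1}` (outer edges),
`v_i v_{i+k}` (inner edges) and `u_i v_i` (spokes), for `i` modulo `n`. -/
def graph (n k : ℕ) : SimpleGraph (Vertex n) :=
  SimpleGraph.fromRel fun x y =>
    (∃ i : ZMod n, x = Vertex.u i ∧ y = Vertex.u (i + 1)) ∨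
    (∃ i : ZMod n, x = Vertex.v i ∧ y = Vertex.v (i + (k : ZMod n))) ∨
    (∃ i : ZMod n, x = Vertex.u i ∧ y = Vertex.v i)

/-- The diameter of `GP(n,k)`, as a rational number, so that the formulas in which halves and
differences occur are read with exact arithmetic. -/
noncomputable def diamGP (n k : ℕ) : ℚ :=
  ((graph n k).diam : ℚ)

/-- The distance `d(u_0, u_i)` in `GP(n,k)`. -/
noncomputable def distU (n k : ℕ) (i : ZMod n) : ℕ :=
  (graph n k).dist (Vertex.u 0) (Vertex.u i)

/-- The distance `d(u_0, v_i)` in `GP(n,k)`. -/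
noncomputable def distV (n k : ℕ) (i : ZMod n) : ℕ :=
  (graph n k).dist (Vertex.u 0) (Vertex.v i)

/-- The number `s` is an integer `p` with `0 ≤ p ≤ n/2` such that `v_p` is at maximum distance
from `u_0` among all the `v_i`, and
`diam(GP(n,k)) = d(u_0, u_p) = d(u_0, v_p) + 1`.
(`s` is rational only so that index formulas such as `m k + j - (k-1)/2` are read exactly.) -/
def IsPeakIndex (n k : ℕ) (s : ℚ) : Prop :=
  ∃ p : ℕ, (p : ℚ) = s ∧ (p : ℚ) ≤ (n : ℚ) / 2 ∧
    (∀ i : ZMod n, distV n k i ≤ distV n k (p : ZMod n)) ∧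
    (graph n k).diam = distU n k (p : ZMod n) ∧
    distU n k (p : ZMod n) = distV n k (p : ZMod n) + 1

end GeneralizedPetersen

open GeneralizedPetersen

/-!
A path of `GP(n,k)` that takes `a` outer and `b` inner steps, counted with sign, changes the index
by `a + k b`. Hence, with `f i` the least cost `|a| + |b|` of a representation `i ≡ a + k b`
modulo `n`, `d(u_0, v_i) = f i + 1`, and `d(u_0, u_i)` is the smaller of `f i + 2` and the length
of the way from `u_0` to `u_i` along the outer rim. If `M` is the maximum of `f`, attained at an
index `p ≤ n / 2` with `p ≥ M + 2`, then the diameter is `M + 2` and `p` is a peak index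
(`diam_eq_and_isPeakIndex`).

It remains to study `f`. A representation of the integer `q k + r` with `0 ≤ r ≤ k` costs at least
the minimum of `q + r` and `q + 1 + k - r` (`min_le_cost`), as it is best to overshoot or
undershoot to a neighbouring multiple of `k`. The cost of `p + t n` therefore has an explicit
lower bound for `t = 0` and `t = -1`; for every other `t` the number `|p + t n|` is at least
`n + p`, and the quadratic lower bound on `n` makes this too large to be represented at a cost below
`M` (`IsPeakOffset.le_cost`). Conversely, every residue has a representation of cost at most `M`
among those obtained by rounding `i` or `i - n` (`IsPeakOffset.exists_cost_le`). Writing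
`n = 2 (m k + j) + e`, `M = m + c` and `p = m k + ρ`, all conditions that matter, collected in
`IsPeakOffset`, are linear in `k`, `j`, `e`, `c` and `ρ` and independent of `m`, so that each case
of the theorem is settled by linear integer arithmetic.
-/

namespace GeneralizedPetersen

/-! ### Distances in `GP(n,k)` and representations `a + k b` -/

lemma edist_outer_edge (n k : ℕ) (i : ZMod n) :
    (graph n k).edist (Vertex.u i) (Vertex.u (i + 1)) ≤ 1 := by
  rw [SimpleGraph.edist_le_one_iff_adj_or_eq, graph, SimpleGraph.fromRel_adj]
  by_cases h : Vertex.u i = Vertex.u (i + 1)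
  · exact Or.inr h
  · exact Or.inl ⟨h, Or.inl (Or.inl ⟨i, rfl, rfl⟩)⟩

lemma edist_inner_edge (n k : ℕ) (i : ZMod n) :
    (graph n k).edist (Vertex.v i) (Vertex.v (i + (k : ZMod n))) ≤ 1 := by
  rw [SimpleGraph.edist_le_one_iff_adj_or_eq, graph, SimpleGraph.fromRel_adj]
  by_cases h : Vertex.v i = Vertex.v (i + (k : ZMod n))
  · exact Or.inr h
  · exact Or.inl ⟨h, Or.inl (Or.inr (Or.inl ⟨i, rfl, rfl⟩))⟩

lemma edist_spoke (n k : ℕ) (i : ZMod n) :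
    (graph n k).edist (Vertex.u i) (Vertex.v i) ≤ 1 := by
  rw [SimpleGraph.edist_le_one_iff_adj_or_eq, graph, SimpleGraph.fromRel_adj]
  exact Or.inl ⟨by simp, Or.inl (Or.inr (Or.inr ⟨i, rfl, rfl⟩))⟩

/-- If a shift by `g` moves each `f i` by distance at most one, then a shift by `b • g` moves it by
distance at most `|b|`. -/
lemma edist_zsmul_le {V A : Type*} [AddCommGroup A] (G : SimpleGraph V) (f : A → V) (g : A)
    (h : ∀ i, G.edist (f i) (f (i + g)) ≤ 1) (i : A) (b : ℤ) :
    G.edist (f i) (f (i + b • g)) ≤ b.natAbs := by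
  have key : ∀ (c : ℕ) (i : A), G.edist (f i) (f (i + c • g)) ≤ c := by
    intro c
    induction c with
    | zero => intro i; simp
    | succ c ih =>
      intro i
      have h2 := h (i + c • g)
      rw [add_assoc, ← succ_nsmul] at h2
      push_cast
      exact SimpleGraph.edist_triangle.trans (add_le_add (ih i) h2)
  obtain ⟨c, rfl | rfl⟩ := Int.eq_nat_or_neg b
  · simpa using key c i
  · have := key c (i + (-(c : ℤ)) • g)
    rw [SimpleGraph.edist_comm]
    simpa [add_assoc] using this

lemma edist_u_v_le (n k : ℕ) (i : ZMod n) (a b : ℤ) :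
    (graph n k).edist (Vertex.u i) (Vertex.v (i + ((a + k * b : ℤ) : ZMod n))) ≤
      ((a.natAbs + b.natAbs + 1 : ℕ) : ℕ∞) := by
  have h1 := edist_zsmul_le (graph n k) Vertex.u 1 (edist_outer_edge n k) i a
  have h2 := edist_spoke n k (i + a • 1)
  have h3 := edist_zsmul_le (graph n k) Vertex.v (k : ZMod n) (edist_inner_edge n k) (i + a • 1) b
  have e : i + ((a + k * b : ℤ) : ZMod n) = i + a • 1 + b • (k : ZMod n) := by
    simp [zsmul_eq_mul]; ring
  rw [e]
  calc _ ≤ _ := SimpleGraph.edist_triangle (v := Vertex.v (i + a • 1))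
    _ ≤ _ := add_le_add (SimpleGraph.edist_triangle (v := Vertex.u (i + a • 1))) le_rfl
    _ ≤ (a.natAbs + 1 + b.natAbs : ℕ∞) := add_le_add (add_le_add h1 h2) h3
    _ = _ := by push_cast; ring

/-- The vertex `x` is reached within length `L` from `u_0`, in terms of the number `a` of outer
steps and the number `b` of inner steps, both counted with sign: an inner vertex costs at least one
spoke, and an outer vertex costs at least two spokes unless the inner rim is avoided. -/
def ReachedWithin (n k : ℕ) (L : ℕ) : Vertex n → Prop
  | .u i => (∃ a : ℤ, (a : ZMod n) = i ∧ a.natAbs ≤ L) ∨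
      ∃ a b : ℤ, ((a + k * b : ℤ) : ZMod n) = i ∧ a.natAbs + b.natAbs + 2 ≤ L
  | .v i => ∃ a b : ℤ, ((a + k * b : ℤ) : ZMod n) = i ∧ a.natAbs + b.natAbs + 1 ≤ L

lemma ReachedWithin.of_adj {n k L : ℕ} {x y : Vertex n} (h : (graph n k).Adj x y)
    (hx : ReachedWithin n k L x) : ReachedWithin n k (L + 1) y := by
  rw [graph, SimpleGraph.fromRel_adj] at h
  obtain ⟨-, (⟨i, rfl, rfl⟩ | ⟨i, rfl, rfl⟩ | ⟨i, rfl, rfl⟩) |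
    (⟨i, rfl, rfl⟩ | ⟨i, rfl, rfl⟩ | ⟨i, rfl, rfl⟩)⟩ := h
  · obtain ⟨a, h, hL⟩ | ⟨a, b, h, hL⟩ := hx
    · exact Or.inl ⟨a + 1, by rw [← h]; push_cast; ring, by omega⟩
    · exact Or.inr ⟨a + 1, b, by rw [← h]; push_cast; ring, by omega⟩
  · obtain ⟨a, b, h, hL⟩ := hx
    exact ⟨a, b + 1, by rw [← h]; push_cast; ring, by omega⟩
  · obtain ⟨a, h, hL⟩ | ⟨a, b, h, hL⟩ := hx
    · exact ⟨a, 0, by rw [← h]; push_cast; ring, by omega⟩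
    · exact ⟨a, b, h, by omega⟩
  · obtain ⟨a, h, hL⟩ | ⟨a, b, h, hL⟩ := hx
    · exact Or.inl ⟨a - 1, by push_cast; rw [h]; ring, by omega⟩
    · exact Or.inr ⟨a - 1, b, by push_cast at h ⊢; linear_combination h, by omega⟩
  · obtain ⟨a, b, h, hL⟩ := hx
    exact ⟨a, b - 1, by push_cast at h ⊢; linear_combination h, by omega⟩
  · obtain ⟨a, b, h, hL⟩ := hx
    exact Or.inr ⟨a, b, h, by omega⟩

lemma ReachedWithin.of_walk {n k : ℕ} {x y : Vertex n} (w : (graph n k).Walk x y) :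
    ∀ {L : ℕ}, ReachedWithin n k L x → ReachedWithin n k (L + w.length) y := by
  induction w with
  | nil => intro L h; exact h
  | cons hadj w ih =>
    intro L h
    have := ih (h.of_adj hadj)
    rwa [SimpleGraph.Walk.length_cons, Nat.add_comm w.length 1, ← Nat.add_assoc]

/-- A vertex at finite distance `dist` from `u_0` is reached within that length. -/
lemma reachedWithin_dist {n k : ℕ} {x : Vertex n}
    (h : (graph n k).edist (Vertex.u 0) x ≠ ⊤) :
    ReachedWithin n k ((graph n k).dist (Vertex.u 0) x) x := by
  obtain ⟨w, hw⟩ := SimpleGraph.Reachable.exists_walk_length_eq_dist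
    (SimpleGraph.reachable_of_edist_ne_top h)
  have h0 : ReachedWithin n k 0 (Vertex.u 0) := Or.inl ⟨0, by simp, by simp⟩
  have := ReachedWithin.of_walk w h0
  rwa [hw, Nat.zero_add] at this

/-- Reduction of the diameter of `GP(n,k)` to the covering radius of the map `(a, b) ↦ a + k b`:
if every residue has a representation of cost `|a| + |b| ≤ M`, and `p` has none of cost below `M`,
then, provided the outer rim gives no shortcut to `u_p`, the index `p` is a peak and the diameter
is `M + 2`. -/
theorem diam_eq_and_isPeakIndex {n k M p : ℕ}
    (hU : ∀ i : ZMod n, ∃ a b : ℤ, ((a + k * b : ℤ) : ZMod n) = i ∧ a.natAbs + b.natAbs ≤ M)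
    (hL : ∀ a b : ℤ, ((a + k * b : ℤ) : ZMod n) = (p : ZMod n) → M ≤ a.natAbs + b.natAbs)
    (hp : 2 * p ≤ n) (hMp : M + 2 ≤ p) :
    (graph n k).diam = M + 2 ∧ IsPeakIndex n k p := by
  have huv : ∀ i j : ZMod n, (graph n k).edist (Vertex.u i) (Vertex.v j) ≤ ((M + 1 : ℕ) : ℕ∞) := by
    intro i j
    obtain ⟨a, b, hab, hM⟩ := hU (j - i)
    have := edist_u_v_le n k i a b
    rw [hab, add_sub_cancel] at this
    exact this.trans (by exact_mod_cast Nat.add_le_add_right hM 1)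
  have hall : ∀ x y : Vertex n, (graph n k).edist x y ≤ ((M + 2 : ℕ) : ℕ∞) := by
    have e : ((M + 2 : ℕ) : ℕ∞) = ((M + 1 : ℕ) : ℕ∞) + 1 := by push_cast; rfl
    have hle : ((M + 1 : ℕ) : ℕ∞) ≤ ((M + 2 : ℕ) : ℕ∞) := by exact_mod_cast Nat.le_succ _
    rintro (i | i) (j | j)
    · rw [e]
      exact SimpleGraph.edist_triangle.trans (add_le_add (huv i j)
        (SimpleGraph.edist_comm.trans_le (edist_spoke n k j)))
    · exact (huv i j).trans hle
    · exact (SimpleGraph.edist_comm.trans_le (huv j i)).trans hle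
    · rw [e, add_comm]
      exact SimpleGraph.edist_triangle.trans (add_le_add
        (SimpleGraph.edist_comm.trans_le (edist_spoke n k i)) (huv i j))
  have hne : ∀ x y : Vertex n, (graph n k).edist x y ≠ ⊤ := fun x y h =>
    absurd (hall x y) (by rw [h]; simp)
  have hed : (graph n k).ediam ≤ ((M + 2 : ℕ) : ℕ∞) := SimpleGraph.ediam_le_of_edist_le hall
  have hdiam_le : (graph n k).diam ≤ M + 2 := by
    have := ENat.toNat_le_toNat hed (ENat.natCast_ne_top _)
    rwa [ENat.toNat_natCast] at this
  have hdist : ∀ {x y : Vertex n} {N : ℕ}, (graph n k).edist x y ≤ (N : ℕ∞) →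
      (graph n k).dist x y ≤ N := by
    intro x y N h
    have := ENat.toNat_le_toNat h (ENat.natCast_ne_top _)
    rwa [ENat.toNat_natCast] at this
  have hV : M + 1 ≤ distV n k p := by
    obtain ⟨a, b, hab, h⟩ := reachedWithin_dist (hne (Vertex.u 0) (Vertex.v (p : ZMod n)))
    have := hL a b hab
    unfold distV
    omega
  have hUd : M + 2 ≤ distU n k p := by
    unfold distU
    obtain ⟨a, ha, h⟩ | ⟨a, b, hab, h⟩ :=
      reachedWithin_dist (hne (Vertex.u 0) (Vertex.u (p : ZMod n)))
    · -- `a ≡ p` modulo `n` and `2 p ≤ n` force `p ≤ |a|`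
      have h2 : ((p : ℤ) : ZMod n) = (a : ZMod n) := by rw [ha]; simp
      obtain ⟨t, ht⟩ := (ZMod.intCast_eq_intCast_iff_dvd_sub _ _ _).1 h2
      have : p ≤ a.natAbs := by
        rcases lt_trichotomy t 0 with h | h | h
        · have : (n : ℤ) * t ≤ n * (-1) := by gcongr; omega
          omega
        · subst h; omega
        · have : (n : ℤ) * 1 ≤ n * t := by gcongr; omega
          omega
      omega
    · have := hL a b hab
      omega
  have hV' : ∀ i, distV n k i ≤ M + 1 := fun i => hdist (huv 0 i)
  have hUd' : distU n k p ≤ M + 2 := hdist (hall _ _)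
  have hd : distU n k p ≤ (graph n k).diam :=
    SimpleGraph.dist_le_diam (ne_top_of_le_ne_top (ENat.natCast_ne_top _) hed)
  have := hV' p
  refine ⟨by omega, p, rfl, ?_, fun i => (hV' i).trans hV, by omega, by omega⟩
  rw [le_div_iff₀ (by norm_num)]
  exact_mod_cast (by omega : p * 2 ≤ n)

/-! ### The cost of representations modulo `n` -/

/-- A representation `a + k b` of `q k + r` cannot be cheaper than both of those with `b = q` and
`b = q + 1`, which is sharp for `0 ≤ r ≤ k`. -/
lemma min_le_cost {k q r a b c : ℤ} (hk : 1 ≤ k)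
    (h : a + k * b = q * k + r) (h1 : c ≤ q + r) (h2 : c ≤ q + 1 + k - r) : c ≤ |a| + |b| := by
  obtain ⟨d, rfl⟩ : ∃ d, b = q + d := ⟨b - q, by ring⟩
  have ha : a = r - k * d := by linarith
  subst ha
  rcases le_or_gt d 0 with hd | hd
  · have h3 : k * d ≤ 1 * d := mul_le_mul_of_nonpos_right hk hd
    have h4 := le_abs_self (r - k * d)
    have h5 := le_abs_self (q + d)
    linarith
  · have h3 : k * 1 ≤ k * d := by gcongr; omega
    have h4 := neg_abs_le (r - k * d)
    have h5 := le_abs_self (q + d)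
    linarith

/-- For every `m`, this bounds the cost `|a| + |b|` of a representation `a + k b` of `m k + σ` below
by `m + c`; the three cases arise from a quotient of `m k + σ` by `k` equal to `m`, `m - 1` or
`m + 1`. -/
def CostBound (k c σ : ℤ) : Prop :=
  (c ≤ σ ∧ c ≤ 1 + k - σ) ∨
  (c + 1 ≤ σ + k ∧ c ≤ -σ) ∨
  (c ≤ 1 + σ - k ∧ c ≤ 2 + 2 * k - σ)

lemma CostBound.le_cost {k c σ m a b : ℤ} (hk : 1 ≤ k) (hσ : CostBound k c σ)
    (h : a + k * b = m * k + σ) : m + c ≤ |a| + |b| := by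
  obtain ⟨h1, h2⟩ | ⟨h1, h2⟩ | ⟨h1, h2⟩ := hσ
  · exact min_le_cost hk h (by linarith) (by linarith)
  · exact min_le_cost (q := m - 1) (r := σ + k) hk
      (by rw [h]; ring) (by linarith) (by linarith)
  · exact min_le_cost (q := m + 1) (r := σ - k) hk
      (by rw [h]; ring) (by linarith) (by linarith)

lemma abs_add_mul_le {k a b : ℤ} (hk : 1 ≤ k) : |a + k * b| ≤ k * (|a| + |b|) := by
  have h1 := abs_add_le a (k * b)
  rw [abs_mul, abs_of_nonneg (by linarith : (0 : ℤ) ≤ k)] at h1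
  nlinarith [abs_nonneg a]

/-- With `n = 2 (m k + j) + e`, the data for a peak at the index `m k + ρ` with covering radius
`m + c`, as conditions that do not involve `m`. -/
structure IsPeakOffset (k j e c ρ : ℤ) : Prop where
  /-- With `s` and `r` determined by `i = (m - s) k + r`, one of five representations of `i` or of
  `i - n` costs at most `m + c`. -/
  cover : ∀ s r : ℤ, 0 ≤ s → 0 ≤ r → r < k → r ≤ c + s ∨ k + 1 - r ≤ c + s ∨
    |2 * j + e - r| ≤ c - s ∨ |2 * j + e - r - k| ≤ c - s - 1 ∨ |2 * j + e - r + k| ≤ c - s + 1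
  /-- No representation of the peak itself costs less than `m + c`. -/
  bound : CostBound k c ρ
  /-- No representation of the peak reduced by `n` costs less than `m + c`. -/
  bound_sub : CostBound k c (2 * j + e - ρ)
  nonneg : 0 ≤ c
  le_half : 2 * c ≤ k + 1
  neg_lt : -k < ρ
  two_mul_le : 2 * ρ ≤ 2 * j + e

section

variable {n k m j e : ℕ} {c ρ : ℤ}

lemma IsPeakOffset.exists_cost_le (h : IsPeakOffset k j e c ρ) (hn : n = 2 * (m * k + j) + e)
    (he : e ≤ 1) (hj : j < k) (hm : 1 ≤ m) (i : ZMod n) :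
    ∃ a b : ℤ, ((a + k * b : ℤ) : ZMod n) = i ∧ |a| + |b| ≤ m + c := by
  have hk : (0 : ℤ) < k := by omega
  have hmk : 1 * k ≤ m * k := by gcongr
  have : NeZero n := ⟨by omega⟩
  have hnn : ((n : ℤ) : ZMod n) = 0 := by simp
  have hnZ : (n : ℤ) = 2 * (m * k + j) + e := by exact_mod_cast hn
  -- negation reduces to the residues up to `n / 2`
  have main : ∀ z : ℤ, 0 ≤ z → 2 * z ≤ n →
      ∃ a b : ℤ, ((a + k * b : ℤ) : ZMod n) = (z : ZMod n) ∧ |a| + |b| ≤ m + c := by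
    intro z hz hzn
    have hr0 := Int.emod_nonneg z hk.ne'
    have hrk := Int.emod_lt_of_pos z hk
    have hzq := Int.mul_ediv_add_emod z k
    have hq0 : 0 ≤ z / k := Int.ediv_nonneg hz hk.le
    have hqm : z / k ≤ m := by
      by_contra! hlt
      have : (k : ℤ) * (m + 1) ≤ k * (z / k) := by gcongr; omega
      nlinarith
    generalize z % k = r at *
    generalize z / k = q at *
    have hb : ∀ x : ℤ, 0 ≤ x → |-x| = x := fun x hx => by rw [abs_neg, abs_of_nonneg hx]
    have hs : (0 : ℤ) ≤ m - q := by omega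
    -- representations of `z - n` by `-a` and `-b`
    have hneg : ∀ a b : ℤ, a + k * b = n - z → 0 ≤ b → |a| + b ≤ m + c →
        ∃ a b : ℤ, ((a + k * b : ℤ) : ZMod n) = (z : ZMod n) ∧ |a| + |b| ≤ m + c := by
      intro a b hab hb0 hle
      refine ⟨-a, -b, ?_, by rwa [abs_neg, hb b hb0]⟩
      rw [show -a + k * -b = z - n by linarith, Int.cast_sub, hnn, sub_zero]
    rcases h.cover (m - q) r hs hr0 hrk with h1 | h1 | h1 | h1 | h1
    · exact ⟨r, q, by rw [← hzq]; push_cast; ring,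
        by rw [abs_of_nonneg hr0, abs_of_nonneg hq0]; linarith⟩
    · refine ⟨r - k, q + 1, by rw [← hzq]; push_cast; ring, ?_⟩
      rw [abs_of_nonneg (by linarith : 0 ≤ q + 1), abs_of_nonpos (by linarith)]
      linarith
    · exact hneg (2 * j + e - r) (m + (m - q)) (by rw [hnZ, ← hzq]; ring) (by linarith)
        (by linarith)
    · exact hneg (2 * j + e - r - k) (m + (m - q) + 1) (by rw [hnZ, ← hzq]; ring)
        (by linarith) (by linarith)
    · exact hneg (2 * j + e - r + k) (m + (m - q) - 1) (by rw [hnZ, ← hzq]; ring)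
        (by omega) (by linarith)
  have hi : ((i.val : ℤ) : ZMod n) = i := by simp
  have hlt := i.val_lt
  rcases le_or_gt (2 * i.val) n with h2 | h2
  · obtain ⟨a, b, hab, hc⟩ := main i.val (by positivity) (by exact_mod_cast h2)
    exact ⟨a, b, hab.trans hi, hc⟩
  · obtain ⟨a, b, hab, hc⟩ := main (n - i.val) (by omega) (by omega)
    refine ⟨-a, -b, ?_, by rwa [abs_neg, abs_neg]⟩
    rw [show -a + k * -b = -(a + k * b) by ring, Int.cast_neg, hab, Int.cast_sub, hnn, hi]
    ring

lemma IsPeakOffset.le_cost (h : IsPeakOffset k j e c ρ) (hn : n = 2 * (m * k + j) + e)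
    (hk : 1 ≤ k) (hkn : k * ((k + 1) / 2) ≤ n) {a b : ℤ}
    (hab : ((a + k * b : ℤ) : ZMod n) = ((m * k + ρ : ℤ) : ZMod n)) : m + c ≤ |a| + |b| := by
  have hk' : (1 : ℤ) ≤ k := by exact_mod_cast hk
  have hnZ : (n : ℤ) = 2 * (m * k + j) + e := by exact_mod_cast hn
  have htwo := h.two_mul_le
  obtain ⟨t, ht⟩ := (ZMod.intCast_eq_intCast_iff_dvd_sub _ _ _).1 hab.symm
  -- away from `p` and `p - n`, the absolute value of `a + k b` is too large
  have far : (n : ℤ) + (m * k + ρ) ≤ |a + k * b| → m + c ≤ |a| + |b| := by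
    intro hfar
    have h1 : (n : ℤ) + (m * k + ρ) ≤ k * (|a| + |b|) := hfar.trans (abs_add_mul_le hk')
    have h2 : (k : ℤ) * ((k + 1) / 2 : ℕ) ≤ n := by exact_mod_cast hkn
    have h3 : c ≤ ((k + 1) / 2 : ℕ) := by have := h.le_half; omega
    have h4 : (k : ℤ) * c ≤ k * ((k + 1) / 2 : ℕ) := by gcongr
    have h5 := h.neg_lt
    have h6 : (k : ℤ) * (m + c - 1) < k * (|a| + |b|) := by linarith
    have := lt_of_mul_lt_mul_left h6 (by linarith)
    linarith
  rcases lt_trichotomy t 0 with h0 | h0 | h0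
  · rcases eq_or_lt_of_le (by omega : t ≤ -1) with h1 | h1
    · subst h1
      rw [← abs_neg a, ← abs_neg b]
      exact h.bound_sub.le_cost hk' (by linarith)
    · have : (n : ℤ) * t ≤ n * (-2) := by gcongr; omega
      refine far (le_trans ?_ (neg_le_abs _))
      linarith
  · subst h0
    exact h.bound.le_cost hk' (by linarith)
  · have : (n : ℤ) * 1 ≤ n * t := by gcongr; omega
    refine far (le_trans ?_ (le_abs_self _))
    linarith

theorem IsPeakOffset.diamGP_eq_and_isPeakIndex (h : IsPeakOffset k j e c ρ)
    (hn : n = 2 * (m * k + j) + e) (he : e ≤ 1) (hj : j < k) (hm : 1 ≤ m)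
    (hkn : k * ((k + 1) / 2) ≤ n) (hrim : (m : ℤ) + c + 2 ≤ m * k + ρ) {D s : ℚ}
    (hD : D = m + c + 2) (hs : s = m * k + ρ) : diamGP n k = D ∧ IsPeakIndex n k s := by
  have hc := h.nonneg
  have h2 := h.two_mul_le
  obtain ⟨M, hM⟩ := Int.eq_ofNat_of_zero_le (by omega : (0 : ℤ) ≤ m + c)
  obtain ⟨p, hp⟩ := Int.eq_ofNat_of_zero_le (by omega : (0 : ℤ) ≤ m * k + ρ)
  have hMQ : (m : ℚ) + c = M := by exact_mod_cast hM
  have hpQ : (m : ℚ) * k + ρ = p := by exact_mod_cast hp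
  have key : (graph n k).diam = M + 2 ∧ IsPeakIndex n k p := by
    refine diam_eq_and_isPeakIndex (fun i => ?_) (fun a b hab => ?_) (by omega) (by omega)
    · obtain ⟨a, b, hab, hle⟩ := h.exists_cost_le hn he hj hm i
      exact ⟨a, b, hab, by zify; linarith⟩
    · have := h.le_cost (a := a) (b := b) hn (by omega) hkn (by rw [hab, hp]; simp)
      zify; linarith
  rw [hs, hpQ, hD, hMQ, diamGP, key.1]
  exact ⟨by push_cast; rfl, key.2⟩

end

/-! ### The size of `n` -/

/-- The conditions of the theorem on `n` and `k`, with the two quadratic lower bounds on `n` written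
as one by means of `⌈k / 2⌉`. -/
structure IsLargeEnough (n k : ℕ) : Prop where
  three_le : 3 ≤ k
  two_mul_lt : 2 * k < n
  of_eq_three : k = 3 → 8 ≤ n
  of_eq_four : k = 4 → 10 ≤ n
  mul_half_le : k * ((k + 1) / 2) ≤ n

lemma isLargeEnough {n k : ℕ} (hk : 3 ≤ k) (hkn : (k : ℚ) < n / 2)
    (hn3 : k = 3 → 8 ≤ n) (hn4 : k = 4 → 10 ≤ n)
    (hnodd : Odd k → 5 ≤ k → (k : ℚ) * (k + 1) / 2 ≤ n)
    (hneven : Even k → 6 ≤ k → (k : ℚ) ^ 2 / 2 ≤ n) : IsLargeEnough n k := by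
  refine ⟨hk, by exact_mod_cast (by linarith : 2 * (k : ℚ) < n), hn3, hn4, ?_⟩
  rcases Nat.even_or_odd' k with ⟨κ, hκ | hκ⟩
  · have hkQ : (k : ℚ) = 2 * κ := by exact_mod_cast hκ
    rw [show (k + 1) / 2 = κ by omega]
    rcases (by omega : k = 4 ∨ 6 ≤ k) with h | h
    · have := hn4 h
      obtain rfl : κ = 2 := by omega
      omega
    · have := hneven ⟨κ, by omega⟩ h
      exact_mod_cast (by rw [hkQ] at this ⊢; linarith : (k : ℚ) * κ ≤ n)
  · have hkQ : (k : ℚ) = 2 * κ + 1 := by exact_mod_cast hκ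
    rw [show (k + 1) / 2 = κ + 1 by omega]
    rcases (by omega : k = 3 ∨ 5 ≤ k) with h | h
    · have := hn3 h
      obtain rfl : κ = 1 := by omega
      omega
    · have := hnodd ⟨κ, by omega⟩ h
      exact_mod_cast (by rw [hkQ] at this ⊢; linarith : (k : ℚ) * (κ + 1) ≤ n)

namespace IsLargeEnough

variable {n k m j e : ℕ}

lemma one_le_quotient (hL : IsLargeEnough n k) (hn : n = 2 * (m * k + j) + e) (he : e ≤ 1)
    (hj : j < k) : 1 ≤ m := by
  have := hL.two_mul_lt
  by_contra! h
  obtain rfl : m = 0 := by omega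
  omega

/-- The quadratic lower bound on `n` leaves only four values of `k` with `n < 4 k`. -/
lemma of_quotient_eq_one (hL : IsLargeEnough n k) (hn : n = 2 * (m * k + j) + e) (he : e ≤ 1)
    (hj : j < k) (hm : m = 1) :
    k = 3 ∧ 1 ≤ j ∨ k = 4 ∧ 1 ≤ j ∨ k = 5 ∧ 5 ≤ 2 * j + e ∨ k = 6 ∧ 3 ≤ j := by
  subst hm
  obtain ⟨hk, -, hn3, hn4, hkn⟩ := hL
  have hk6 : k ≤ 6 := by
    by_contra! h
    have : k * 4 ≤ k * ((k + 1) / 2) := by gcongr; omega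
    omega
  interval_cases k <;> omega

/-- For `m ≥ 2` the requirement that `p = m k + ρ` exceed the covering radius `m + c` by at least
two follows from its instance `m = 2`. -/
lemma diamGP_eq_and_isPeakIndex (hL : IsLargeEnough n k) (hn : n = 2 * (m * k + j) + e)
    (he : e ≤ 1) (hj : j < k) {c ρ : ℤ} {D s : ℚ} (h : IsPeakOffset k j e c ρ)
    (h1 : m = 1 → c + 3 ≤ k + ρ) (h2 : c + 4 ≤ 2 * k + ρ) (hD : D = m + c + 2)
    (hs : s = m * k + ρ) : diamGP n k = D ∧ IsPeakIndex n k s := by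
  have hm := hL.one_le_quotient hn he hj
  have hk := hL.three_le
  refine h.diamGP_eq_and_isPeakIndex hn he hj hm hL.mul_half_le ?_ hD hs
  rcases eq_or_lt_of_le hm with h3 | h3
  · have := h1 h3.symm
    rw [← h3]
    push_cast
    linarith
  · have h4 : (2 : ℤ) * (k - 1) ≤ m * (k - 1) := by gcongr <;> omega
    linarith

end IsLargeEnough

/-! ### The peaks, by the parities of `k` and `n` -/

/-!
The value of `c` is read off from the diameter `m + c + 2`, and that of `ρ` from the peak `m k + ρ`.
The rational hypotheses are first turned into integer ones on `j` and `κ`, where `k` is `2 κ` or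
`2 κ + 1`.
-/

theorem IsLargeEnough.peaks_of_odd_of_even {n k : ℕ} (hL : IsLargeEnough n k) (hk : Odd k)
    {m j : ℕ} (hmj : (n : ℚ) / 2 = m * k + j) :
    (((k : ℚ) - 1) / 2 ≤ j → j < k →
      ((j : ℚ) = (k - 1) / 2 ∨ (j : ℚ) = (k + 1) / 2 →
        diamGP n k = m + 2 + j ∧ IsPeakIndex n k (m * k + j)) ∧
      (3 ≤ 2 * (j : ℚ) - k → 2 * (j : ℚ) - k ≤ (k + 1) / 2 →
        diamGP n k = m + 3 + k - j ∧ IsPeakIndex n k (m * k + j)) ∧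
      (2 * (j : ℚ) - k > (k + 1) / 2 →
        diamGP n k = m + 2 + j - (k - 1) / 2 ∧ IsPeakIndex n k (m * k + j - (k - 1) / 2))) ∧
    ((j : ℚ) < (k - 1) / 2 →
      (j = 0 ∨ j = 1 →
        diamGP n k = m + 1 + (k + 1) / 2 ∧ IsPeakIndex n k ((m - 1) * k + (k + 1) / 2)) ∧
      (4 ≤ 2 * j → 2 * (j : ℚ) ≤ (k + 1) / 2 →
        diamGP n k = m + 3 + (k - 1) / 2 - j ∧
        IsPeakIndex n k ((m - 1) * k + (k + 1) / 2 + j - 1)) ∧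
      (2 * (j : ℚ) > (k + 1) / 2 →
        diamGP n k = m + 2 + j ∧ IsPeakIndex n k ((m - 1) * k + j + 1))) := by
  obtain ⟨κ, hκ⟩ := hk
  have hk3 := hL.three_le
  have hkQ : (k : ℚ) = 2 * κ + 1 := by exact_mod_cast hκ
  have hn : n = 2 * (m * k + j) + 0 := by
    exact_mod_cast (by linarith : (n : ℚ) = 2 * (m * k + j) + 0)
  refine ⟨fun hlo hjk => ?_, fun hhi => ?_⟩
  · have hj0 : (κ : ℤ) ≤ (j : ℤ) := by exact_mod_cast (by linarith : (κ : ℚ) ≤ (j : ℚ))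
    have hm1 := hL.of_quotient_eq_one hn (by omega) hjk
    have peak := @IsLargeEnough.diamGP_eq_and_isPeakIndex n k m j 0
      hL hn (by omega) hjk
    refine ⟨?_, ?_, ?_⟩
    · intro hj
      have hZ : (j : ℤ) = (κ : ℤ) ∨ (j : ℤ) = (κ : ℤ) + 1 := by
        refine hj.imp (fun h => ?_) (fun h => ?_)
        · exact_mod_cast (by linarith : (j : ℚ) = (κ : ℚ))
        · exact_mod_cast (by linarith : (j : ℚ) = (κ : ℚ) + 1)
      exact peak (c := j) (ρ := j)
        (by constructor <;> intros <;> (try simp only [abs_le, CostBound]) <;> omega)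
        (by omega) (by omega) (by push_cast; linarith) (by push_cast; linarith)
    · intro h1 h2
      have hZ1 : 2 * (j : ℤ) ≥ 2 * (κ : ℤ) + 4 := by
        exact_mod_cast (by linarith : 2 * (j : ℚ) ≥ 2 * (κ : ℚ) + 4)
      have hZ2 : 4 * (j : ℤ) ≤ 6 * (κ : ℤ) + 4 := by
        exact_mod_cast (by linarith : 4 * (j : ℚ) ≤ 6 * (κ : ℚ) + 4)
      exact peak (c := 1 + k - j) (ρ := j)
        (by constructor <;> intros <;> (try simp only [abs_le, CostBound]) <;> omega)
        (by omega) (by omega) (by push_cast; linarith) (by push_cast; linarith)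
    · intro h1
      have hZ1 : 4 * (j : ℤ) > 6 * (κ : ℤ) + 4 := by
        exact_mod_cast (by linarith : 4 * (j : ℚ) > 6 * (κ : ℚ) + 4)
      exact peak (c := j - κ) (ρ := j - κ)
        (by constructor <;> intros <;> (try simp only [abs_le, CostBound]) <;> omega)
        (by omega) (by omega) (by push_cast; linarith) (by push_cast; linarith)
  · have hj0 : (j : ℤ) < (κ : ℤ) := by exact_mod_cast (by linarith : (j : ℚ) < (κ : ℚ))
    have hjk : j < k := by omega
    have hm1 := hL.of_quotient_eq_one hn (by omega) hjk
    have peak := @IsLargeEnough.diamGP_eq_and_isPeakIndex n k m j 0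
      hL hn (by omega) hjk
    refine ⟨?_, ?_, ?_⟩
    · intro hj
      exact peak (c := κ) (ρ := κ + 1 - k)
        (by constructor <;> intros <;> (try simp only [abs_le, CostBound]) <;> omega)
        (by omega) (by omega) (by push_cast; linarith) (by push_cast; linarith)
    · intro h1 h2
      have hZ1 : 2 * (j : ℤ) ≤ (κ : ℤ) + 1 := by
        exact_mod_cast (by linarith : 2 * (j : ℚ) ≤ (κ : ℚ) + 1)
      exact peak (c := 1 + κ - j) (ρ := κ + j - k)
        (by constructor <;> intros <;> (try simp only [abs_le, CostBound]) <;> omega)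
        (by omega) (by omega) (by push_cast; linarith) (by push_cast; linarith)
    · intro h1
      have hZ1 : 2 * (j : ℤ) > (κ : ℤ) + 1 := by
        exact_mod_cast (by linarith : 2 * (j : ℚ) > (κ : ℚ) + 1)
      exact peak (c := j) (ρ := j + 1 - k)
        (by constructor <;> intros <;> (try simp only [abs_le, CostBound]) <;> omega)
        (by omega) (by omega) (by push_cast; linarith) (by push_cast; linarith)

theorem IsLargeEnough.peaks_of_odd_of_odd {n k : ℕ} (hL : IsLargeEnough n k) (hk : Odd k)
    {m j : ℕ} (hmj : ((n : ℚ) - 1) / 2 = m * k + j) :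
    (((k : ℚ) - 2) / 2 ≤ j → j < k →
      ((j : ℚ) = (k - 1) / 2 →
        diamGP n k = m + 2 + (k - 1) / 2 ∧ IsPeakIndex n k (m * k + (k - 1) / 2)) ∧
      (2 ≤ 2 * (j : ℚ) + 1 - k → 2 * (j : ℚ) + 1 - k ≤ (k + 1) / 2 →
        diamGP n k = m + 2 + k - j ∧ IsPeakIndex n k (m * k + j)) ∧
      (2 * (j : ℚ) + 1 - k > (k + 1) / 2 →
        diamGP n k = m + 2 + j - (k - 1) / 2 ∧
        IsPeakIndex n k (m * k + j - (k - 3) / 2) ∧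
        IsPeakIndex n k (m * k + j - (k - 1) / 2))) ∧
    ((j : ℚ) < (k - 2) / 2 →
      (1 ≤ 2 * j + 1 → 2 * (j : ℚ) + 1 ≤ (k + 1) / 2 →
        diamGP n k = m + 2 + (k - 1) / 2 - j ∧
        (j = 0 → IsPeakIndex n k ((m - 1) * k + (k + 1) / 2)) ∧
        (1 ≤ j → IsPeakIndex n k ((m - 1) * k + (k + 1) / 2 + j - 1) ∧
          IsPeakIndex n k ((m - 1) * k + (k + 1) / 2 + j))) ∧
      (2 * (j : ℚ) + 1 > (k + 1) / 2 →
        diamGP n k = m + 2 + j ∧ IsPeakIndex n k ((m - 1) * k + j + 2) ∧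
        IsPeakIndex n k ((m - 1) * k + j + 1))) := by
  obtain ⟨κ, hκ⟩ := hk
  have hk3 := hL.three_le
  have hkQ : (k : ℚ) = 2 * κ + 1 := by exact_mod_cast hκ
  have hn : n = 2 * (m * k + j) + 1 := by
    exact_mod_cast (by linarith : (n : ℚ) = 2 * (m * k + j) + 1)
  refine ⟨fun hlo hjk => ?_, fun hhi => ?_⟩
  · have hj0 : 2 * (κ : ℤ) - 1 ≤ 2 * (j : ℤ) := by
      exact_mod_cast (by linarith : 2 * (κ : ℚ) - 1 ≤ 2 * (j : ℚ))
    have hm1 := hL.of_quotient_eq_one hn (by omega) hjk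
    have peak := @IsLargeEnough.diamGP_eq_and_isPeakIndex n k m j 1
      hL hn (by omega) hjk
    refine ⟨?_, ?_, ?_⟩
    · intro h1
      have hZ1 : (j : ℤ) = (κ : ℤ) := by exact_mod_cast (by linarith : (j : ℚ) = (κ : ℚ))
      exact peak (c := κ) (ρ := κ)
        (by constructor <;> intros <;> (try simp only [abs_le, CostBound]) <;> omega)
        (by omega) (by omega) (by push_cast; linarith) (by push_cast; linarith)
    · intro h1 h2
      have hZ1 : (j : ℤ) ≥ (κ : ℤ) + 1 := by exact_mod_cast (by linarith : (j : ℚ) ≥ (κ : ℚ) + 1)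
      have hZ2 : 4 * (j : ℤ) ≤ 6 * (κ : ℤ) + 2 := by
        exact_mod_cast (by linarith : 4 * (j : ℚ) ≤ 6 * (κ : ℚ) + 2)
      exact peak (c := k - j) (ρ := j)
        (by constructor <;> intros <;> (try simp only [abs_le, CostBound]) <;> omega)
        (by omega) (by omega) (by push_cast; linarith) (by push_cast; linarith)
    · intro h1
      have hZ1 : 4 * (j : ℤ) > 6 * (κ : ℤ) + 2 := by
        exact_mod_cast (by linarith : 4 * (j : ℚ) > 6 * (κ : ℚ) + 2)
      exact and_and_left.2 ⟨peak (c := j - κ) (ρ := j - κ + 1)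
        (by constructor <;> intros <;> (try simp only [abs_le, CostBound]) <;> omega)
        (by omega) (by omega) (by push_cast; linarith) (by push_cast; linarith),
        peak (c := j - κ) (ρ := j - κ)
        (by constructor <;> intros <;> (try simp only [abs_le, CostBound]) <;> omega)
        (by omega) (by omega) (by push_cast; linarith) (by push_cast; linarith)⟩
  · have hj0 : 2 * (j : ℤ) < 2 * (κ : ℤ) - 1 := by
      exact_mod_cast (by linarith : 2 * (j : ℚ) < 2 * (κ : ℚ) - 1)
    have hjk : j < k := by omega
    have hm1 := hL.of_quotient_eq_one hn (by omega) hjk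
    have peak := @IsLargeEnough.diamGP_eq_and_isPeakIndex n k m j 1
      hL hn (by omega) hjk
    refine ⟨?_, ?_⟩
    · intro h1 h2
      have hZ1 : 2 * (j : ℤ) ≤ (κ : ℤ) := by exact_mod_cast (by linarith : 2 * (j : ℚ) ≤ (κ : ℚ))
      rcases Nat.eq_zero_or_pos j with hj0 | hj0
      · have hjQ : (j : ℚ) = 0 := by exact_mod_cast hj0
        have hp : diamGP n k = m + 2 + (k - 1) / 2 - j ∧
            IsPeakIndex n k ((m - 1) * k + (k + 1) / 2) := peak (c := κ - j) (ρ := κ + 1 - k)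
          (by constructor <;> intros <;> (try simp only [abs_le, CostBound]) <;> omega)
          (by omega) (by omega) (by push_cast; linarith) (by push_cast; linarith)
        exact ⟨hp.1, fun _ => hp.2, fun h => absurd h (by omega)⟩
      · have hp : diamGP n k = m + 2 + (k - 1) / 2 - j ∧
            IsPeakIndex n k ((m - 1) * k + (k + 1) / 2 + j - 1) :=
                peak (c := κ - j) (ρ := κ + j - k)
          (by constructor <;> intros <;> (try simp only [abs_le, CostBound]) <;> omega)
          (by omega) (by omega) (by push_cast; linarith) (by push_cast; linarith)
        exact ⟨hp.1, fun h => absurd h (by omega), fun _ => ⟨hp.2,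
            (peak (c := κ - j) (ρ := κ + 1 + j - k)
          (by constructor <;> intros <;> (try simp only [abs_le, CostBound]) <;> omega)
          (by omega) (by omega) (by push_cast; linarith) (by push_cast; linarith)).2⟩⟩
    · intro h1
      have hZ1 : 2 * (j : ℤ) > (κ : ℤ) := by exact_mod_cast (by linarith : 2 * (j : ℚ) > (κ : ℚ))
      exact and_and_left.2 ⟨peak (c := j) (ρ := j + 2 - k)
        (by constructor <;> intros <;> (try simp only [abs_le, CostBound]) <;> omega)
        (by omega) (by omega) (by push_cast; linarith) (by push_cast; linarith),
        peak (c := j) (ρ := j + 1 - k)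
        (by constructor <;> intros <;> (try simp only [abs_le, CostBound]) <;> omega)
        (by omega) (by omega) (by push_cast; linarith) (by push_cast; linarith)⟩

theorem IsLargeEnough.peaks_of_even_of_even {n k : ℕ} (hL : IsLargeEnough n k) (hk : Even k)
    {m j : ℕ} (hmj : (n : ℚ) / 2 = m * k + j) :
    (((k : ℚ) - 2) / 2 ≤ j → j < k →
      ((j : ℚ) = (k - 2) / 2 ∨ (j : ℚ) = k / 2 →
        diamGP n k = m + 2 + j ∧ IsPeakIndex n k (m * k + j)) ∧
      (2 ≤ 2 * (j : ℚ) - k → 2 * (j : ℚ) - k ≤ k / 2 →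
        diamGP n k = m + 3 + k - j ∧ IsPeakIndex n k (m * k + j)) ∧
      (2 * (j : ℚ) - k ≥ (k + 2) / 2 →
        diamGP n k = m + 2 + j - k / 2 ∧ IsPeakIndex n k (m * k + j - k / 2 + 1) ∧
        IsPeakIndex n k (m * k + j - k / 2))) ∧
    ((j : ℚ) < (k - 2) / 2 →
      (j = 0 →
        diamGP n k = m + 1 + k / 2 ∧ IsPeakIndex n k ((m - 1) * k + k / 2)) ∧
      (2 ≤ 2 * j → 2 * (j : ℚ) ≤ k / 2 →
        diamGP n k = m + 2 + k / 2 - j ∧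
        IsPeakIndex n k ((m - 1) * k + k / 2 + j - 1) ∧
        (2 ≤ j → IsPeakIndex n k ((m - 1) * k + k / 2 + j))) ∧
      (2 * (j : ℚ) ≥ (k + 2) / 2 →
        diamGP n k = m + 2 + j ∧ IsPeakIndex n k ((m - 1) * k + j + 1))) := by
  obtain ⟨κ, hκ⟩ := hk
  have hk3 := hL.three_le
  have hkQ : (k : ℚ) = κ + κ := by exact_mod_cast hκ
  have hn : n = 2 * (m * k + j) + 0 := by
    exact_mod_cast (by linarith : (n : ℚ) = 2 * (m * k + j) + 0)
  refine ⟨fun hlo hjk => ?_, fun hhi => ?_⟩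
  · have hj0 : (κ : ℤ) - 1 ≤ (j : ℤ) := by exact_mod_cast (by linarith : (κ : ℚ) - 1 ≤ (j : ℚ))
    have hm1 := hL.of_quotient_eq_one hn (by omega) hjk
    have peak := @IsLargeEnough.diamGP_eq_and_isPeakIndex n k m j 0
      hL hn (by omega) hjk
    refine ⟨?_, ?_, ?_⟩
    · intro hj
      have hZ : (j : ℤ) = (κ : ℤ) - 1 ∨ (j : ℤ) = (κ : ℤ) := by
        refine hj.imp (fun h => ?_) (fun h => ?_)
        · exact_mod_cast (by linarith : (j : ℚ) = (κ : ℚ) - 1)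
        · exact_mod_cast (by linarith : (j : ℚ) = (κ : ℚ))
      exact peak (c := j) (ρ := j)
        (by constructor <;> intros <;> (try simp only [abs_le, CostBound]) <;> omega)
        (by omega) (by omega) (by push_cast; linarith) (by push_cast; linarith)
    · intro h1 h2
      have hZ1 : (j : ℤ) ≥ (κ : ℤ) + 1 := by exact_mod_cast (by linarith : (j : ℚ) ≥ (κ : ℚ) + 1)
      have hZ2 : 2 * (j : ℤ) ≤ 3 * (κ : ℤ) := by
        exact_mod_cast (by linarith : 2 * (j : ℚ) ≤ 3 * (κ : ℚ))
      exact peak (c := 1 + k - j) (ρ := j)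
        (by constructor <;> intros <;> (try simp only [abs_le, CostBound]) <;> omega)
        (by omega) (by omega) (by push_cast; linarith) (by push_cast; linarith)
    · intro h1
      have hZ1 : 2 * (j : ℤ) ≥ 3 * (κ : ℤ) + 1 := by
        exact_mod_cast (by linarith : 2 * (j : ℚ) ≥ 3 * (κ : ℚ) + 1)
      exact and_and_left.2 ⟨peak (c := j - κ) (ρ := j - κ + 1)
        (by constructor <;> intros <;> (try simp only [abs_le, CostBound]) <;> omega)
        (by omega) (by omega) (by push_cast; linarith) (by push_cast; linarith),
        peak (c := j - κ) (ρ := j - κ)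
        (by constructor <;> intros <;> (try simp only [abs_le, CostBound]) <;> omega)
        (by omega) (by omega) (by push_cast; linarith) (by push_cast; linarith)⟩
  · have hj0 : (j : ℤ) < (κ : ℤ) - 1 := by exact_mod_cast (by linarith : (j : ℚ) < (κ : ℚ) - 1)
    have hjk : j < k := by omega
    have hm1 := hL.of_quotient_eq_one hn (by omega) hjk
    have peak := @IsLargeEnough.diamGP_eq_and_isPeakIndex n k m j 0
      hL hn (by omega) hjk
    refine ⟨?_, ?_, ?_⟩
    · intro hj
      exact peak (c := κ - 1) (ρ := κ - k)
        (by constructor <;> intros <;> (try simp only [abs_le, CostBound]) <;> omega)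
        (by omega) (by omega) (by push_cast; linarith) (by push_cast; linarith)
    · intro h1 h2
      have hZ1 : 2 * (j : ℤ) ≤ (κ : ℤ) := by exact_mod_cast (by linarith : 2 * (j : ℚ) ≤ (κ : ℚ))
      have hp : diamGP n k = m + 2 + k / 2 - j ∧
          IsPeakIndex n k ((m - 1) * k + k / 2 + j - 1) := peak (c := κ - j) (ρ := κ + j - 1 - k)
        (by constructor <;> intros <;> (try simp only [abs_le, CostBound]) <;> omega)
        (by omega) (by omega) (by push_cast; linarith) (by push_cast; linarith)
      exact ⟨hp.1, hp.2, fun hj2 => (peak (c := κ - j) (ρ := κ + j - k)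
        (by constructor <;> intros <;> (try simp only [abs_le, CostBound]) <;> omega)
        (by omega) (by omega) (by push_cast; linarith) (by push_cast; linarith)).2⟩
    · intro h1
      have hZ1 : 2 * (j : ℤ) ≥ (κ : ℤ) + 1 := by
        exact_mod_cast (by linarith : 2 * (j : ℚ) ≥ (κ : ℚ) + 1)
      exact peak (c := j) (ρ := j + 1 - k)
        (by constructor <;> intros <;> (try simp only [abs_le, CostBound]) <;> omega)
        (by omega) (by omega) (by push_cast; linarith) (by push_cast; linarith)

theorem IsLargeEnough.peaks_of_even_of_odd {n k : ℕ} (hL : IsLargeEnough n k) (hk : Even k)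
    {m j : ℕ} (hmj : ((n : ℚ) - 1) / 2 = m * k + j) :
    (((k : ℚ) - 3) / 2 ≤ j → j < k →
      ((j : ℚ) = (k - 2) / 2 →
        diamGP n k = m + 2 + (k - 2) / 2 ∧ IsPeakIndex n k (m * k + j)) ∧
      (1 ≤ 2 * (j : ℚ) + 1 - k → 2 * (j : ℚ) + 1 - k ≤ k / 2 →
        diamGP n k = m + 2 + k - j ∧ IsPeakIndex n k (m * k + j)) ∧
      (2 * (j : ℚ) + 1 - k ≥ (k + 2) / 2 →
        diamGP n k = m + 3 + j - k / 2 ∧ IsPeakIndex n k (m * k + j + 1 - k / 2))) ∧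
    ((j : ℚ) < (k - 3) / 2 →
      (j = 0 →
        diamGP n k = m + 1 + k / 2 ∧ IsPeakIndex n k ((m - 1) * k + k / 2)) ∧
      (3 ≤ 2 * j + 1 → 2 * (j : ℚ) + 1 ≤ k / 2 →
        diamGP n k = m + 2 + k / 2 - j ∧ IsPeakIndex n k ((m - 1) * k + k / 2 + j)) ∧
      (2 * (j : ℚ) + 1 ≥ (k + 2) / 2 →
        diamGP n k = m + 2 + j ∧ IsPeakIndex n k ((m - 1) * k + j + 2) ∧
        IsPeakIndex n k ((m - 1) * k + j + 1))) := by
  obtain ⟨κ, hκ⟩ := hk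
  have hk3 := hL.three_le
  have hkQ : (k : ℚ) = κ + κ := by exact_mod_cast hκ
  have hn : n = 2 * (m * k + j) + 1 := by
    exact_mod_cast (by linarith : (n : ℚ) = 2 * (m * k + j) + 1)
  refine ⟨fun hlo hjk => ?_, fun hhi => ?_⟩
  · have hj0 : 2 * (κ : ℤ) - 3 ≤ 2 * (j : ℤ) := by
      exact_mod_cast (by linarith : 2 * (κ : ℚ) - 3 ≤ 2 * (j : ℚ))
    have hm1 := hL.of_quotient_eq_one hn (by omega) hjk
    have peak := @IsLargeEnough.diamGP_eq_and_isPeakIndex n k m j 1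
      hL hn (by omega) hjk
    refine ⟨?_, ?_, ?_⟩
    · intro h1
      have hZ1 : (j : ℤ) = (κ : ℤ) - 1 := by exact_mod_cast (by linarith : (j : ℚ) = (κ : ℚ) - 1)
      exact peak (c := j) (ρ := j)
        (by constructor <;> intros <;> (try simp only [abs_le, CostBound]) <;> omega)
        (by omega) (by omega) (by push_cast; linarith) (by push_cast; linarith)
    · intro h1 h2
      have hZ1 : 2 * (j : ℤ) ≥ 2 * (κ : ℤ) := by
        exact_mod_cast (by linarith : 2 * (j : ℚ) ≥ 2 * (κ : ℚ))
      have hZ2 : 2 * (j : ℤ) ≤ 3 * (κ : ℤ) - 1 := by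
        exact_mod_cast (by linarith : 2 * (j : ℚ) ≤ 3 * (κ : ℚ) - 1)
      exact peak (c := k - j) (ρ := j)
        (by constructor <;> intros <;> (try simp only [abs_le, CostBound]) <;> omega)
        (by omega) (by omega) (by push_cast; linarith) (by push_cast; linarith)
    · intro h1
      have hZ1 : 2 * (j : ℤ) ≥ 3 * (κ : ℤ) := by
        exact_mod_cast (by linarith : 2 * (j : ℚ) ≥ 3 * (κ : ℚ))
      exact peak (c := 1 + j - κ) (ρ := j + 1 - κ)
        (by constructor <;> intros <;> (try simp only [abs_le, CostBound]) <;> omega)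
        (by omega) (by omega) (by push_cast; linarith) (by push_cast; linarith)
  · have hj0 : 2 * (j : ℤ) < 2 * (κ : ℤ) - 3 := by
      exact_mod_cast (by linarith : 2 * (j : ℚ) < 2 * (κ : ℚ) - 3)
    have hjk : j < k := by omega
    have hm1 := hL.of_quotient_eq_one hn (by omega) hjk
    have peak := @IsLargeEnough.diamGP_eq_and_isPeakIndex n k m j 1
      hL hn (by omega) hjk
    refine ⟨?_, ?_, ?_⟩
    · intro hj
      exact peak (c := κ - 1) (ρ := κ - k)
        (by constructor <;> intros <;> (try simp only [abs_le, CostBound]) <;> omega)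
        (by omega) (by omega) (by push_cast; linarith) (by push_cast; linarith)
    · intro h1 h2
      have hZ1 : 2 * (j : ℤ) + 1 ≤ (κ : ℤ) := by
        exact_mod_cast (by linarith : 2 * (j : ℚ) + 1 ≤ (κ : ℚ))
      exact peak (c := κ - j) (ρ := κ + j - k)
        (by constructor <;> intros <;> (try simp only [abs_le, CostBound]) <;> omega)
        (by omega) (by omega) (by push_cast; linarith) (by push_cast; linarith)
    · intro h1
      have hZ1 : 2 * (j : ℤ) + 1 ≥ (κ : ℤ) + 1 := by
        exact_mod_cast (by linarith : 2 * (j : ℚ) + 1 ≥ (κ : ℚ) + 1)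
      exact and_and_left.2 ⟨peak (c := j) (ρ := j + 2 - k)
        (by constructor <;> intros <;> (try simp only [abs_le, CostBound]) <;> omega)
        (by omega) (by omega) (by push_cast; linarith) (by push_cast; linarith),
        peak (c := j) (ρ := j + 1 - k)
        (by constructor <;> intros <;> (try simp only [abs_le, CostBound]) <;> omega)
        (by omega) (by omega) (by push_cast; linarith) (by push_cast; linarith)⟩

end GeneralizedPetersen

theorem theorem3p1 (n k : ℕ) (hk : 3 ≤ k) (hkn : (k : ℚ) < n / 2)
    (hn3 : k = 3 → 8 ≤ n) (hn4 : k = 4 → 10 ≤ n)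
    (hnodd : Odd k → 5 ≤ k → (k : ℚ) * (k + 1) / 2 ≤ n)
    (hneven : Even k → 6 ≤ k → (k : ℚ) ^ 2 / 2 ≤ n) :
    -- `k` odd, `n` even
    (Odd k → Even n → ∀ m j : ℕ, (n : ℚ) / 2 = m * k + j →
      (((k : ℚ) - 1) / 2 ≤ j → j < k →
        ((j : ℚ) = (k - 1) / 2 ∨ (j : ℚ) = (k + 1) / 2 →
          diamGP n k = m + 2 + j ∧ IsPeakIndex n k (m * k + j)) ∧
        (3 ≤ 2 * (j : ℚ) - k → 2 * (j : ℚ) - k ≤ (k + 1) / 2 →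
          diamGP n k = m + 3 + k - j ∧ IsPeakIndex n k (m * k + j)) ∧
        (2 * (j : ℚ) - k > (k + 1) / 2 →
          diamGP n k = m + 2 + j - (k - 1) / 2 ∧ IsPeakIndex n k (m * k + j - (k - 1) / 2))) ∧
      ((j : ℚ) < (k - 1) / 2 →
        (j = 0 ∨ j = 1 →
          diamGP n k = m + 1 + (k + 1) / 2 ∧ IsPeakIndex n k ((m - 1) * k + (k + 1) / 2)) ∧
        (4 ≤ 2 * j → 2 * (j : ℚ) ≤ (k + 1) / 2 →
          diamGP n k = m + 3 + (k - 1) / 2 - j ∧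
          IsPeakIndex n k ((m - 1) * k + (k + 1) / 2 + j - 1)) ∧
        (2 * (j : ℚ) > (k + 1) / 2 →
          diamGP n k = m + 2 + j ∧ IsPeakIndex n k ((m - 1) * k + j + 1)))) ∧
    -- `k` odd, `n` odd
    (Odd k → Odd n → ∀ m j : ℕ, ((n : ℚ) - 1) / 2 = m * k + j →
      (((k : ℚ) - 2) / 2 ≤ j → j < k →
        ((j : ℚ) = (k - 1) / 2 →
          diamGP n k = m + 2 + (k - 1) / 2 ∧ IsPeakIndex n k (m * k + (k - 1) / 2)) ∧
        (2 ≤ 2 * (j : ℚ) + 1 - k → 2 * (j : ℚ) + 1 - k ≤ (k + 1) / 2 →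
          diamGP n k = m + 2 + k - j ∧ IsPeakIndex n k (m * k + j)) ∧
        (2 * (j : ℚ) + 1 - k > (k + 1) / 2 →
          diamGP n k = m + 2 + j - (k - 1) / 2 ∧
          IsPeakIndex n k (m * k + j - (k - 3) / 2) ∧
          IsPeakIndex n k (m * k + j - (k - 1) / 2))) ∧
      ((j : ℚ) < (k - 2) / 2 →
        (1 ≤ 2 * j + 1 → 2 * (j : ℚ) + 1 ≤ (k + 1) / 2 →
          diamGP n k = m + 2 + (k - 1) / 2 - j ∧
          (j = 0 → IsPeakIndex n k ((m - 1) * k + (k + 1) / 2)) ∧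
          (1 ≤ j → IsPeakIndex n k ((m - 1) * k + (k + 1) / 2 + j - 1) ∧
            IsPeakIndex n k ((m - 1) * k + (k + 1) / 2 + j))) ∧
        (2 * (j : ℚ) + 1 > (k + 1) / 2 →
          diamGP n k = m + 2 + j ∧ IsPeakIndex n k ((m - 1) * k + j + 2) ∧
          IsPeakIndex n k ((m - 1) * k + j + 1)))) ∧
    -- `k` even, `n` even
    (Even k → Even n → ∀ m j : ℕ, (n : ℚ) / 2 = m * k + j →
      (((k : ℚ) - 2) / 2 ≤ j → j < k →
        ((j : ℚ) = (k - 2) / 2 ∨ (j : ℚ) = k / 2 →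
          diamGP n k = m + 2 + j ∧ IsPeakIndex n k (m * k + j)) ∧
        (2 ≤ 2 * (j : ℚ) - k → 2 * (j : ℚ) - k ≤ k / 2 →
          diamGP n k = m + 3 + k - j ∧ IsPeakIndex n k (m * k + j)) ∧
        (2 * (j : ℚ) - k ≥ (k + 2) / 2 →
          diamGP n k = m + 2 + j - k / 2 ∧ IsPeakIndex n k (m * k + j - k / 2 + 1) ∧
          IsPeakIndex n k (m * k + j - k / 2))) ∧
      ((j : ℚ) < (k - 2) / 2 →
        (j = 0 →
          diamGP n k = m + 1 + k / 2 ∧ IsPeakIndex n k ((m - 1) * k + k / 2)) ∧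
        (2 ≤ 2 * j → 2 * (j : ℚ) ≤ k / 2 →
          diamGP n k = m + 2 + k / 2 - j ∧
          IsPeakIndex n k ((m - 1) * k + k / 2 + j - 1) ∧
          (2 ≤ j → IsPeakIndex n k ((m - 1) * k + k / 2 + j))) ∧
        (2 * (j : ℚ) ≥ (k + 2) / 2 →
          diamGP n k = m + 2 + j ∧ IsPeakIndex n k ((m - 1) * k + j + 1)))) ∧
    -- `k` even, `n` odd
    (Even k → Odd n → ∀ m j : ℕ, ((n : ℚ) - 1) / 2 = m * k + j →
      (((k : ℚ) - 3) / 2 ≤ j → j < k →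
        ((j : ℚ) = (k - 2) / 2 →
          diamGP n k = m + 2 + (k - 2) / 2 ∧ IsPeakIndex n k (m * k + j)) ∧
        (1 ≤ 2 * (j : ℚ) + 1 - k → 2 * (j : ℚ) + 1 - k ≤ k / 2 →
          diamGP n k = m + 2 + k - j ∧ IsPeakIndex n k (m * k + j)) ∧
        (2 * (j : ℚ) + 1 - k ≥ (k + 2) / 2 →
          diamGP n k = m + 3 + j - k / 2 ∧ IsPeakIndex n k (m * k + j + 1 - k / 2))) ∧
      ((j : ℚ) < (k - 3) / 2 →
        (j = 0 →
          diamGP n k = m + 1 + k / 2 ∧ IsPeakIndex n k ((m - 1) * k + k / 2)) ∧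
        (3 ≤ 2 * j + 1 → 2 * (j : ℚ) + 1 ≤ k / 2 →
          diamGP n k = m + 2 + k / 2 - j ∧ IsPeakIndex n k ((m - 1) * k + k / 2 + j)) ∧
        (2 * (j : ℚ) + 1 ≥ (k + 2) / 2 →
          diamGP n k = m + 2 + j ∧ IsPeakIndex n k ((m - 1) * k + j + 2) ∧
          IsPeakIndex n k ((m - 1) * k + j + 1)))) := by
  have hL := isLargeEnough hk hkn hn3 hn4 hnodd hneven
  exact ⟨fun h _ _ _ => hL.peaks_of_odd_of_even h, fun h _ _ _ => hL.peaks_of_odd_of_odd h,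
    fun h _ _ _ => hL.peaks_of_even_of_even h, fun h _ _ _ => hL.peaks_of_even_of_odd h⟩
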